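/- All spaces are Hausdorff. For an ordinal $\alpha$, let $2^{\alpha}_{\mathrm{lex}}$ be the set of all functions $\alpha\to 2=\{0,1\}$ with the lexicographic order and its order topology. Points $a,b$ of a compact space $X$ are \emph{pin equivalent} if there are a compact space $Y$, a continuous surjection $f\colon Y\to X$ and a homeomorphism $g\colon Y\to Y$ with $g(f^{-1}\{a\})=f^{-1}\{b\}$; a compact space is \emph{pin homogeneous} if every two of its points are pin equivalent. A set $\mathcal S$ of subsets of $X$ is a \emph{neighborhood subbase} at $a\in X$ if the neighborhood filter of $a$ is the smallest filter containing $\mathcal S$. Subalgebras $A_0,\dots,A_n$ of a Boolean algebra are \emph{independent} if $x_0\wedge\dots\wedge x_n\neq 0$ whenever $0\neq x_m\in A_m$ for all $m\le n$. Theorem. For each $n<\omega$, the product space $X=\prod_{m\le n}2^{\omega_m}_{\mathrm{lex}}$ is compact and pin homogeneous. Moreover, every point $y\in X$ has a neighborhood subbase of the form $\bigcup_{m\le n}\{R^m_\alpha : \alpha<\omega_m\}$, where for each $m\le n$ the sequence $(R^m_\alpha)_{\alpha<\omega_m}$ of subsets of $X$ is strictly decreasing ($R^m_\alpha\supsetneq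 R^m_\beta$ for $\alpha<\beta<\omega_m$), and the subalgebras $\mathcal A_0,\dots,\mathcal A_n$ of the power set Boolean algebra $\mathcal P(X)$, with $\mathcal A_m$ generated by $\{R^m_\alpha:\alpha<\omega_m\}$, are independent. -/

import Mathlib

open scoped Ordinal Topology

universe u

/-- Subsets `A`, `B` of a compact Hausdorff space `X` are pin equivalent if, for some compact
Hausdorff `Y`, continuous surjection `f : Y → X` and homeomorphism `g : Y → Y`, the image under
`g` of the preimage of `A` is the preimage of `B`.  (Meant for closed `A`, `B`.) -/
def SetsPinEquivalent {X : Type u} [TopologicalSpace X] (A B : Set X) : Prop :=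
  ∃ (Y : Type u) (_ : TopologicalSpace Y) (_ : CompactSpace Y) (_ : T2Space Y)
    (f : Y → X) (g : Y ≃ₜ Y),
    Continuous f ∧ Function.Surjective f ∧ g '' (f ⁻¹' A) = f ⁻¹' B

/-- Pin equivalence of points. -/
def PinEquivalent {X : Type u} [TopologicalSpace X] (a b : X) : Prop :=
  SetsPinEquivalent {a} {b}

/-- A pin homogeneous space: a compact Hausdorff space all of whose pairs of points are pin
equivalent. -/
structure PinHomogeneous (X : Type u) [TopologicalSpace X] : Prop where
  compact : CompactSpace X
  hausdorff : T2Space X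
  pinEquivalent : ∀ a b : X, PinEquivalent a b

/-- The set of all functions from the ordinal `α` to `2`; a fresh type, so that it carries only the
order and the topology given below. -/
def TwoLex (α : Ordinal.{u}) : Type u := Lex (α.ToType → Fin 2)

/-- The lexicographic order: `f < g` iff `f i < g i` at the least `i` where they differ. -/
noncomputable instance (α : Ordinal.{u}) : LinearOrder (TwoLex α) :=
  inferInstanceAs (LinearOrder (Lex (α.ToType → Fin 2)))

/-- The order topology. -/
noncomputable instance (α : Ordinal.{u}) : TopologicalSpace (TwoLex α) := Preorder.topology (TwoLex α)

instance (α : Ordinal.{u}) : OrderTopology (TwoLex α) := ⟨rfl⟩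

/-- The product of the spaces `2^{ω_m}_lex`, `m ≤ n`, with the product topology. -/
abbrev TwoLexProd (n : ℕ) : Type := ∀ m : Fin (n + 1), TwoLex (ω_ ((m : ℕ) : Ordinal.{0}))

/-- `S` is a neighborhood subbase at `a`: the neighborhood filter of `a` is the smallest filter
containing `S`. -/
def IsNeighborhoodSubbase {X : Type u} [TopologicalSpace X] (a : X) (S : Set (Set X)) : Prop :=
  Filter.generate S = 𝓝 a

/-- Finitely many subalgebras of a Boolean algebra are independent if every choice of one nonzero
element from each has nonzero meet. -/
def IndependentSubalgebras {ι : Type*} [Fintype ι] {B : Type*} [BooleanAlgebra B]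
    (A : ι → BooleanSubalgebra B) : Prop :=
  ∀ x : ι → B, (∀ i, x i ∈ A i) → (∀ i, x i ≠ ⊥) → Finset.univ.inf x ≠ ⊥

/-!
At a point `y` of `2^{ω_m}_lex`, some digit `b` occurs at cofinally many places. The points that do
not branch off from `y` at a place `≤ i` with digit `b` form a clopen set, and as `i` runs through
these places (of order type `ω_m`, which is regular) the sets form a strictly decreasing sequence.
Together with the analogous sets for the other digit they form a neighborhood subbase at `y`. The
places of the other digit have cofinality at most `ω_m`, so that, up to refinement, the second
sequence has length `ω_k` for some `k ≤ m`. In the product it is absorbed into the main sequence of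
the factor `k` by intersecting members with the same index. Changing a single digit of `y` at a
place of the digit `b` prescribes the main trace without touching the other sequence; hence all
combinations of traces are realized in the product. This gives independence at once. It also shows
that, for two points `a` and `b`, "having the same traces on the sequences at `a` as on those at
`b`" is a closed relation, total on both sides, relating `a` exactly to `b`; the shift on the space
of its bi-infinite orbits witnesses pin equivalence.
-/

section PinEquivalence

variable {X : Type u} {r : X → X → Prop}

/-- The bi-infinite sequences whose consecutive terms are related: the inverse limit space on which
the shift turns the relation `r` into a homeomorphism. -/
def biinfiniteOrbits (r : X → X → Prop) : Set (ℤ → X) :=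
  {s | ∀ i, r (s i) (s (i + 1))}

theorem exists_mem_biinfiniteOrbits_apply_zero (hr : Relator.BiTotal r) (x : X) :
    ∃ s ∈ biinfiniteOrbits r, s 0 = x := by
  choose next hnext using hr.1
  choose prev hprev using hr.2
  refine ⟨Int.rec (fun k => next^[k] x) (fun k => prev^[k + 1] x), fun i => ?_, rfl⟩
  match i with
  | .ofNat k =>
    change r (next^[k] x) (next^[k + 1] x)
    rw [Function.iterate_succ_apply']
    exact hnext _
  | .negSucc 0 => exact hprev x
  | .negSucc (k + 1) =>
    change r (prev^[k + 1 + 1] x) (prev^[k + 1] x)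
    rw [Function.iterate_succ_apply' prev (k + 1)]
    exact hprev _

variable [TopologicalSpace X]

theorem isClosed_biinfiniteOrbits (hr : IsClosed {p : X × X | r p.1 p.2}) :
    IsClosed (biinfiniteOrbits r) := by
  simp only [biinfiniteOrbits, Set.ofPred_forall]
  exact isClosed_iInter fun i =>
    hr.preimage (f := fun s : ℤ → X => (s i, s (i + 1))) (by fun_prop)

/-- The shift `s ↦ (i ↦ s (i + 1))` as a homeomorphism of the space of bi-infinite orbits. -/
def biinfiniteOrbitsShift (r : X → X → Prop) : biinfiniteOrbits r ≃ₜ biinfiniteOrbits r where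
  toFun s := ⟨fun i => s.1 (i + 1), fun i => s.2 (i + 1)⟩
  invFun s := ⟨fun i => s.1 (i - 1), fun i => by simpa using s.2 (i - 1)⟩
  left_inv s := by ext i; simp
  right_inv s := by ext i; simp
  continuous_toFun := by
    refine Continuous.subtype_mk (continuous_pi fun i => ?_) _
    exact (continuous_apply (i + 1)).comp continuous_subtype_val
  continuous_invFun := by
    refine Continuous.subtype_mk (continuous_pi fun i => ?_) _
    exact (continuous_apply (i - 1)).comp continuous_subtype_val

theorem setsPinEquivalent_of_isClosed_of_biTotal [CompactSpace X] [T2Space X] {A B : Set X}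
    (hclosed : IsClosed {p : X × X | r p.1 p.2}) (htotal : Relator.BiTotal r)
    (hAB : ∀ x y, r x y → (x ∈ A ↔ y ∈ B)) : SetsPinEquivalent A B := by
  have hcompact : CompactSpace (biinfiniteOrbits r) :=
    isCompact_iff_compactSpace.1 (isClosed_biinfiniteOrbits hclosed).isCompact
  refine ⟨biinfiniteOrbits r, instTopologicalSpaceSubtype, hcompact, inferInstance, fun s => s.1 0,
    biinfiniteOrbitsShift r, (continuous_apply (0 : ℤ)).comp continuous_subtype_val,
    fun x => ?_, ?_⟩
  · obtain ⟨s, hs, hsx⟩ := exists_mem_biinfiniteOrbits_apply_zero htotal x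
    exact ⟨⟨s, hs⟩, hsx⟩
  · rw [← (biinfiniteOrbitsShift r).preimage_symm]
    ext s
    have h : r (s.1 (0 - 1)) (s.1 0) := by simpa using s.2 (0 - 1)
    exact hAB _ _ h

end PinEquivalence

theorem isClosed_setOfPred_mem_iff_mem {X Y : Type*} [TopologicalSpace X] [TopologicalSpace Y]
    {P : Set X} {Q : Set Y} (hP : IsClopen P) (hQ : IsClopen Q) :
    IsClosed {p : X × Y | p.1 ∈ P ↔ p.2 ∈ Q} := by
  have hP' := hP.preimage (continuous_fst : Continuous (Prod.fst : X × Y → X))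
  have hQ' := hQ.preimage (continuous_snd : Continuous (Prod.snd : X × Y → Y))
  simp only [iff_iff_and_or_not_and_not]
  exact ((hP'.inter hQ').union (hP'.compl.inter hQ'.compl)).isClosed

theorem IsNeighborhoodSubbase.forall_mem_iff {X : Type*} [TopologicalSpace X] [T1Space X] {a x : X}
    {S : Set (Set X)} (h : IsNeighborhoodSubbase a S) : (∀ s ∈ S, x ∈ s) ↔ x = a := by
  rw [← pure_le_nhds_iff, ← h, Filter.le_generate_iff]
  rfl

theorem mem_iff_mem_of_mem_closure_range {X ι : Type*} {R : ι → Set X} {x x' : X}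
    (h : ∀ i, x ∈ R i ↔ x' ∈ R i) {Z : Set X}
    (hZ : Z ∈ BooleanSubalgebra.closure (Set.range R)) : x ∈ Z ↔ x' ∈ Z := by
  induction hZ using BooleanSubalgebra.closure_bot_sup_induction with
  | mem _ hZ => obtain ⟨i, rfl⟩ := hZ; exact h i
  | bot => exact Iff.rfl
  | sup _ _ _ _ hZ hW => exact or_congr hZ hW
  | compl _ _ hZ => exact not_congr hZ

/-- Decreasing families of subsets of `X` that are independent in the strongest possible sense: the
trace `{α | x ∈ R i α}` of a point is a lower set for each `i`, and every choice of lower sets is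
the collection of traces of some point. -/
structure IsIndependentChains {X ι : Type*} {L : ι → Type*} [∀ i, Preorder (L i)]
    (R : ∀ i, L i → Set X) : Prop where
  antitone : ∀ i, Antitone (R i)
  exists_trace_eq : ∀ t : ∀ i, LowerSet (L i), ∃ x, ∀ i α, x ∈ R i α ↔ α ∈ t i

namespace IsIndependentChains

variable {X : Type u} {ι : Type*} {L : ι → Type*} [∀ i, Preorder (L i)] {P Q R : ∀ i, L i → Set X}

theorem strictAnti (hR : IsIndependentChains R) (i : ι) : StrictAnti (R i) := by
  classical
  intro α β hαβ
  refine (hR.antitone i hαβ.le).lt_of_not_ge fun hle => ?_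
  obtain ⟨x, hx⟩ := hR.exists_trace_eq (Function.update ⊥ i (LowerSet.Iio β))
  have hxi : ∀ γ, x ∈ R i γ ↔ γ < β := by simpa using hx i
  exact lt_irrefl β ((hxi β).1 (hle ((hxi α).2 hαβ)))

theorem exists_forall_mem_iff_mem (hP : ∀ i, Antitone (P i)) (hQ : IsIndependentChains Q)
    (z : ι → X) : ∃ x, ∀ i α, z i ∈ P i α ↔ x ∈ Q i α := by
  obtain ⟨x, hx⟩ :=
    hQ.exists_trace_eq fun i => ⟨{α | z i ∈ P i α}, fun _ _ h hz => hP i h hz⟩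
  exact ⟨x, fun i α => (hx i α).symm⟩

theorem independentSubalgebras [Fintype ι] (hR : IsIndependentChains R) :
    IndependentSubalgebras fun i => BooleanSubalgebra.closure (Set.range (R i)) := by
  intro Z hZ hne
  choose z hz using fun i => Set.nonempty_iff_ne_empty.2 (hne i)
  obtain ⟨x, hx⟩ := exists_forall_mem_iff_mem hR.antitone hR z
  have hxZ : {x} ≤ Finset.univ.inf Z := Finset.le_inf fun i _ => Set.singleton_subset_iff.2
    ((mem_iff_mem_of_mem_closure_range (hx i) (hZ i)).1 (hz i))
  exact ne_bot_of_le_ne_bot (Set.singleton_ne_empty x) hxZ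

theorem pinEquivalent [TopologicalSpace X] [CompactSpace X] [T2Space X] {a b : X}
    (hP : IsIndependentChains P) (hPclopen : ∀ i α, IsClopen (P i α))
    (hPa : IsNeighborhoodSubbase a (⋃ i, Set.range (P i)))
    (hQ : IsIndependentChains Q) (hQclopen : ∀ i α, IsClopen (Q i α))
    (hQb : IsNeighborhoodSubbase b (⋃ i, Set.range (Q i))) : PinEquivalent a b := by
  refine setsPinEquivalent_of_isClosed_of_biTotal
    (r := fun x y => ∀ i α, x ∈ P i α ↔ y ∈ Q i α) ?_ ⟨fun x => ?_, fun y => ?_⟩ fun x y hxy => ?_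
  · simp only [Set.ofPred_forall]
    exact isClosed_iInter fun i => isClosed_iInter fun α =>
      isClosed_setOfPred_mem_iff_mem (hPclopen i α) (hQclopen i α)
  · exact exists_forall_mem_iff_mem hP.antitone hQ fun _ => x
  · obtain ⟨x, hx⟩ := exists_forall_mem_iff_mem hQ.antitone hP fun _ => y
    exact ⟨x, fun i α => (hx i α).symm⟩
  · rw [Set.mem_singleton_iff, Set.mem_singleton_iff, ← hPa.forall_mem_iff, ← hQb.forall_mem_iff]
    simp only [Set.mem_iUnion, Set.mem_range]
    grind

end IsIndependentChains

namespace TwoLex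

variable {α : Ordinal.{u}}

noncomputable instance : CompleteLinearOrder (TwoLex α) :=
  inferInstanceAs (CompleteLinearOrder (Lex (α.ToType → Fin 2)))

instance : CoeFun (TwoLex α) fun _ => α.ToType → Fin 2 := ⟨fun x => x⟩

/-- The point with the given digits. -/
def ofDigits (f : α.ToType → Fin 2) : TwoLex α := f

@[simp]
theorem ofDigits_apply (f : α.ToType → Fin 2) (i : α.ToType) : ofDigits f i = f i := rfl

theorem lt_def {x y : TwoLex α} : x < y ↔ ∃ i, (∀ j < i, x j = y j) ∧ x i < y i := Iff.rfl

/-- Exchange the digits `0` and `1`. -/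
def flip (x : TwoLex α) : TwoLex α := ofDigits fun i => (x i).rev

@[simp]
theorem flip_apply (x : TwoLex α) (i : α.ToType) : flip x i = (x i).rev := rfl

@[simp]
theorem flip_flip (x : TwoLex α) : flip (flip x) = x :=
  funext fun i => Fin.rev_rev (x i)

theorem flip_lt_flip {x y : TwoLex α} : flip x < flip y ↔ y < x := by
  simp only [lt_def, flip_apply, Fin.rev_inj, Fin.rev_lt_rev]
  simp only [eq_comm]

/-- Exchanging the digits, as an isomorphism onto the dual order. -/
def flipOrderIso : TwoLex α ≃o (TwoLex α)ᵒᵈ where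
  toFun x := OrderDual.toDual (flip x)
  invFun x := flip (OrderDual.ofDual x)
  left_inv := flip_flip
  right_inv := flip_flip
  map_rel_iff' {x y} := by
    change flip y ≤ flip x ↔ x ≤ y
    rw [← not_lt, flip_lt_flip, not_lt]

theorem continuous_flip : Continuous (flip : TwoLex α → TwoLex α) :=
  continuous_ofDual.comp flipOrderIso.continuous

/-- The points that do not branch off from `y` at a place `j ≤ i` where `y` has digit `b`. For
`b = 1` this is a final segment of `TwoLex α` containing `y`, for `b = 0` an initial one. -/
def nearSet (y : TwoLex α) (b : Fin 2) (i : α.ToType) : Set (TwoLex α) :=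
  {x | ∀ j ≤ i, y j = b → (∀ k < j, x k = y k) → x j = b}

theorem nearSet_antitone (y : TwoLex α) (b : Fin 2) : Antitone (nearSet y b) :=
  fun _ _ h _ hx j hj => hx j (hj.trans h)

theorem self_mem_nearSet (y : TwoLex α) (b : Fin 2) (i : α.ToType) : y ∈ nearSet y b i :=
  fun _ _ h _ => h

theorem flip_mem_nearSet_flip {x y : TwoLex α} {b : Fin 2} {i : α.ToType} :
    flip x ∈ nearSet (flip y) b.rev i ↔ x ∈ nearSet y b i := by
  simp only [nearSet, Set.mem_ofPred_eq, flip_apply, Fin.rev_inj]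

theorem nearSet_one_eq_Ici (y : TwoLex α) (i : α.ToType) :
    nearSet y 1 i = Set.Ici (ofDigits fun j => if j ≤ i then y j else 0) := by
  ext x
  rw [Set.mem_Ici, ← not_lt, lt_def]
  simp only [nearSet, Set.mem_ofPred_eq, ofDigits_apply]
  constructor
  · rintro h ⟨j, hj, hlt⟩
    by_cases hji : j ≤ i
    · rw [if_pos hji] at hlt
      have hxj := h j hji (by omega) fun k hk => by rw [hj k hk, if_pos (hk.le.trans hji)]
      omega
    · rw [if_neg hji] at hlt
      omega
  · intro h j hji hyj hk
    by_contra hxj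
    refine h ⟨j, fun k hkj => ?_, ?_⟩
    · rw [if_pos (hkj.le.trans hji), hk k hkj]
    · rw [if_pos hji]
      omega

/-- The lower bound is the immediate predecessor of the one in `nearSet_one_eq_Ici`. -/
theorem nearSet_one_eq_Ioi {y : TwoLex α} {i : α.ToType} (hi : y i = 1) :
    nearSet y 1 i =
      Set.Ioi (ofDigits fun j => if j < i then y j else if j = i then 0 else 1) := by
  refine Set.Subset.antisymm ?_ fun x hx => ?_
  · rw [nearSet_one_eq_Ici]
    refine Set.Ici_subset_Ioi.2 (lt_def.2 ⟨i, fun j hj => ?_, ?_⟩)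
    · simp [hj, hj.le]
    · simp [hi]
  · obtain ⟨j, hj, hlt⟩ := lt_def.1 hx
    simp only [ofDigits_apply] at hj hlt
    have hji : j ≤ i := by
      by_contra hji
      rw [if_neg (by order), if_neg (by order)] at hlt
      omega
    intro k hki hyk hk
    rcases lt_trichotomy k j with hkj | rfl | hjk
    · rw [← hj k hkj, if_pos (by order), hyk]
    · omega
    · rw [if_pos (by order), hk j hjk] at hlt
      exact absurd hlt (lt_irrefl _)

theorem isClopen_nearSet_one {y : TwoLex α} {i : α.ToType} (hi : y i = 1) :
    IsClopen (nearSet y 1 i) :=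
  ⟨nearSet_one_eq_Ici y i ▸ isClosed_Ici, nearSet_one_eq_Ioi hi ▸ isOpen_Ioi⟩

theorem isClopen_nearSet {y : TwoLex α} {b : Fin 2} {i : α.ToType} (hi : y i = b) :
    IsClopen (nearSet y b i) := by
  obtain rfl | rfl : b = 0 ∨ b = 1 := by omega
  · have hflip : nearSet y 0 i = flip ⁻¹' nearSet (flip y) 1 i :=
      Set.ext fun x => flip_mem_nearSet_flip.symm
    rw [hflip]
    exact (isClopen_nearSet_one (by rw [flip_apply, hi]; rfl)).preimage continuous_flip
  · exact isClopen_nearSet_one hi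

theorem nearSet_eq_univ_of_isBot {y : TwoLex α} {b : Fin 2} {i : α.ToType} (hi : IsBot i)
    (hb : y i ≠ b) : nearSet y b i = Set.univ := by
  refine Set.eq_univ_of_forall fun x j hji hj => absurd hj ?_
  rwa [hji.antisymm (hi j)]

theorem exists_nearSet_subset_Ioi {a y : TwoLex α} (h : a < y) :
    ∃ i, nearSet y (y i) i ⊆ Set.Ioi a := by
  obtain ⟨i, hi, hlt⟩ := lt_def.1 h
  refine ⟨i, fun x hx => ?_⟩
  by_contra hax
  have hxy : x < y := lt_of_le_of_lt (not_lt.1 hax) h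
  obtain ⟨j, hj, hj'⟩ := lt_def.1 hxy
  rcases le_or_gt j i with hji | hij
  · have := hx j hji (by omega) hj
    omega
  · exact hax (lt_def.2 ⟨i, fun k hk => by rw [hi k hk, hj k (hk.trans hij)],
      by rwa [hj i hij]⟩)

theorem exists_nearSet_subset_Iio {a y : TwoLex α} (h : y < a) :
    ∃ i, nearSet y (y i) i ⊆ Set.Iio a := by
  obtain ⟨i, hi⟩ := exists_nearSet_subset_Ioi (flip_lt_flip.2 h)
  exact ⟨i, fun x hx => flip_lt_flip.1 (hi (flip_mem_nearSet_flip.2 hx))⟩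

theorem generate_range_nearSet_le_nhds (y : TwoLex α) :
    Filter.generate (Set.range fun i => nearSet y (y i) i) ≤ 𝓝 y := by
  have hmem : ∀ i, nearSet y (y i) i ∈ Filter.generate (Set.range fun i => nearSet y (y i) i) :=
    fun i => Filter.mem_generate_of_mem (Set.mem_range_self i)
  refine Filter.tendsto_id'.1 (tendsto_order.2 ⟨fun a ha => ?_, fun a ha => ?_⟩)
  · obtain ⟨i, hi⟩ := exists_nearSet_subset_Ioi ha
    exact Filter.mem_of_superset (hmem i) hi
  · obtain ⟨i, hi⟩ := exists_nearSet_subset_Iio ha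
    exact Filter.mem_of_superset (hmem i) hi

/-- Change the digit at place `i`. -/
noncomputable def flipAt (y : TwoLex α) (i : α.ToType) : TwoLex α :=
  ofDigits fun j => if j = i then (y j).rev else y j

theorem flipAt_mem_nearSet_iff {y : TwoLex α} {b : Fin 2} {i j : α.ToType} :
    flipAt y i ∈ nearSet y b j ↔ (y i = b → j < i) := by
  have hrev : ∀ a : Fin 2, a.rev ≠ a := by decide
  simp only [nearSet, flipAt, Set.mem_ofPred_eq, ofDigits_apply]
  constructor
  · rintro h rfl
    by_contra hij
    have hflip := h i (not_lt.1 hij) rfl fun k hk => if_neg hk.ne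
    rw [if_pos rfl] at hflip
    exact hrev _ hflip
  · intro h k hkj hk _
    have hki : k ≠ i := by
      rintro rfl
      exact absurd (h hk) (not_lt.2 hkj)
    rw [if_neg hki, hk]

end TwoLex

section Cofinality

open Cardinal Order

theorem isRegular_aleph_natCast (m : ℕ) : (ℵ_ (m : Ordinal.{u})).IsRegular := by
  cases m with
  | zero => simpa using isRegular_aleph0
  | succ m => simpa using isRegular_aleph_add_one (m : Ordinal.{u})

instance isRegularCardinalOrder_omega_natCast (m : ℕ) :
    IsRegularCardinalOrder (ω_ (m : Ordinal.{u})).ToType where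
  type_lt_le_ord_cof := by
    rw [Ordinal.type_toType, Ordinal.cof_toType, (isRegular_aleph_natCast m).cof_omega_eq,
      ord_aleph]

theorem exists_isCofinal_fiber {ι β : Type*} [LinearOrder ι] [Finite β] [Nonempty β] (y : ι → β) :
    ∃ b, IsCofinal {i | y i = b} := by
  by_contra! h
  choose x hx using fun b => not_isCofinal_iff.1 (h b)
  obtain ⟨b, hb⟩ := Finite.exists_max x
  exact (hx (y (x b)) (x b) rfl).not_ge (hb _)

instance nonempty_toType_omega (o : Ordinal.{u}) : Nonempty (ω_ o).ToType :=
  Ordinal.nonempty_toType_iff.2 (Ordinal.omega_pos o).ne'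

theorem exists_orderHom_isCofinal_range {T : Type u} [LinearOrder T] [WellFoundedLT T] [Nonempty T]
    {o : Ordinal.{u}} (hT : #T ≤ ℵ_ o) :
    ∃ k ≤ o, ∃ f : (ω_ k).ToType →o T, IsCofinal (Set.range f) := by
  obtain _ | _ := topOrderOrNoTopOrder T
  · exact ⟨o, le_rfl, OrderHom.const _ ⊤, fun _ => ⟨⊤, ⟨Classical.arbitrary _, rfl⟩, le_top⟩⟩
  obtain ⟨k, hk⟩ := mem_range_aleph_iff.2 (aleph0_le_cof_iff.2 (one_lt_cof (α := T)))
  obtain ⟨s, hs, hstype⟩ := Ordinal.exists_ord_cof_eq T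
  rw [← hk, ord_aleph, ← Ordinal.type_toType (ω_ k)] at hstype
  let e : (ω_ k).ToType ≃o s := .ofRelIsoLT (Ordinal.type_eq.1 hstype.symm).some
  refine ⟨k, aleph_le_aleph.1 (hk.trans_le ((cof_le_cardinalMk T).trans hT)),
    ⟨fun i => (e i : T), e.monotone⟩, fun t => ?_⟩
  obtain ⟨u, hu, htu⟩ := hs t
  exact ⟨u, ⟨e.symm ⟨u, hu⟩, congrArg Subtype.val (e.apply_symm_apply ⟨u, hu⟩)⟩, htu⟩

end Cofinality

/-- The choices from which the subbase at a point `y` of `2^{ω_m}_lex` is built: a digit occurring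
cofinally often, the enumeration of its places in order type `ω_m`, and monotone sequences through
the places of the other digit. Only one of these sequences has to be nonconstant; one of each length
`ω_k` is recorded so that no case distinction on `k` is needed later. The least place is always
allowed, so that the sequences exist even if the other digit does not occur. -/
structure DigitEnumeration {m : ℕ} (y : TwoLex (ω_ (m : Ordinal.{u}))) where
  digit : Fin 2
  places : (ω_ (m : Ordinal.{u})).ToType ≃o {i // y i = digit}
  otherPlaces : ∀ k : ℕ, (ω_ (k : Ordinal.{u})).ToType →o {i // y i ≠ digit ∨ IsBot i}
  exists_le_otherPlaces : ∀ i, ∃ k ≤ m, ∃ α, i ≤ otherPlaces k α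

theorem eq_rev_of_ne {a b : Fin 2} (h : a ≠ b) : a = b.rev := by
  decide +revert

namespace DigitEnumeration

open TwoLex

variable {m : ℕ}

open Cardinal in
theorem nonempty (y : TwoLex (ω_ (m : Ordinal.{u}))) :
    Nonempty (DigitEnumeration y) := by
  obtain ⟨b, hb⟩ := exists_isCofinal_fiber y
  let := WellFoundedLT.toOrderBot (ω_ (m : Ordinal.{u})).ToType
  let leastPlace : {i // y i ≠ b ∨ IsBot i} := ⟨⊥, Or.inr isBot_bot⟩
  have : Nonempty {i // y i ≠ b ∨ IsBot i} := ⟨leastPlace⟩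
  have hcard : #{i // y i ≠ b ∨ IsBot i} ≤ ℵ_ (m : Ordinal.{u}) := by
    simpa using mk_subtype_le fun i => y i ≠ b ∨ IsBot i
  obtain ⟨k, hkm, f, hf⟩ := exists_orderHom_isCofinal_range hcard
  obtain ⟨k, rfl⟩ := Ordinal.lt_omega0.1 (hkm.trans_lt (Ordinal.natCast_lt_omega0 m))
  refine ⟨b, Order.enum _ hb, Function.update (fun _ => OrderHom.const _ leastPlace) k f,
    fun i => ⟨k, by exact_mod_cast hkm, ?_⟩⟩
  obtain ⟨_, ⟨α, rfl⟩, hα⟩ := hf i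
  exact ⟨α, by rwa [Function.update_self]⟩

variable {y : TwoLex (ω_ (m : Ordinal.{u}))} (E : DigitEnumeration y)

theorem isClopen_nearSet_otherPlaces (k : ℕ) (α : (ω_ (k : Ordinal.{u})).ToType) :
    IsClopen (nearSet y E.digit.rev (E.otherPlaces k α)) := by
  by_cases hdigit : y (E.otherPlaces k α) = E.digit.rev
  · exact isClopen_nearSet hdigit
  · have hbot := (E.otherPlaces k α).2.resolve_left (mt eq_rev_of_ne hdigit)
    rw [nearSet_eq_univ_of_isBot hbot hdigit]
    exact isClopen_univ

theorem flipAt_places_mem_nearSet_places (α β : (ω_ (m : Ordinal.{u})).ToType) :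
    flipAt y (E.places α) ∈ nearSet y E.digit (E.places β) ↔ β < α := by
  rw [flipAt_mem_nearSet_iff, Subtype.coe_lt_coe, E.places.lt_iff_lt]
  exact forall_prop_of_true (E.places α).2

theorem flipAt_places_mem_nearSet_rev (α i : (ω_ (m : Ordinal.{u})).ToType) :
    flipAt y (E.places α) ∈ nearSet y E.digit.rev i := by
  have hrev : ∀ b : Fin 2, b ≠ b.rev := by decide
  refine flipAt_mem_nearSet_iff.2 fun h => absurd h ?_
  rw [(E.places α).2]
  exact hrev _

theorem exists_trace_eq (t : LowerSet (ω_ (m : Ordinal.{u})).ToType) :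
    ∃ x, (∀ α, x ∈ nearSet y E.digit (E.places α) ↔ α ∈ t) ∧ ∀ i, x ∈ nearSet y E.digit.rev i := by
  rcases t.lower.eq_univ_or_Iio with ht | ⟨β, ht⟩
  · refine ⟨y, fun α => iff_of_true (self_mem_nearSet _ _ _) ?_, fun i => self_mem_nearSet _ _ _⟩
    exact ht.ge (Set.mem_univ α)
  · refine ⟨flipAt y (E.places β), fun α => ?_, E.flipAt_places_mem_nearSet_rev β⟩
    rw [E.flipAt_places_mem_nearSet_places, ← Set.mem_Iio, ← ht, SetLike.mem_coe]

end DigitEnumeration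

namespace TwoLexProd

open TwoLex

variable {n : ℕ} {y : TwoLexProd n} (E : ∀ m, DigitEnumeration (y m))

/-- The `α`-th member of the `m`-th decreasing sequence of neighborhoods of `y`: a condition on the
`m`-th coordinate for its cofinal digit, and on every coordinate for the other digit. -/
def subbaseSet (m : Fin (n + 1)) (α : (ω_ ((m : ℕ) : Ordinal.{0})).ToType) :
    Set (TwoLexProd n) :=
  {x | x m ∈ nearSet (y m) (E m).digit ((E m).places α) ∧
    ∀ j, x j ∈ nearSet (y j) (E j).digit.rev ((E j).otherPlaces m α)}

theorem antitone_subbaseSet (m : Fin (n + 1)) : Antitone (subbaseSet E m) :=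
  fun _ _ h _ hx => ⟨nearSet_antitone _ _ ((E m).places.monotone h) hx.1,
    fun j => nearSet_antitone _ _ (((E j).otherPlaces m).monotone h) (hx.2 j)⟩

theorem isClopen_subbaseSet (m : Fin (n + 1)) (α : (ω_ ((m : ℕ) : Ordinal.{0})).ToType) :
    IsClopen (subbaseSet E m α) := by
  have hmain : IsClopen ((fun x : TwoLexProd n => x m) ⁻¹'
      nearSet (y m) (E m).digit ((E m).places α)) :=
    (isClopen_nearSet ((E m).places α).2).preimage (continuous_apply m)
  have hother : IsClopen (⋂ j, (fun x : TwoLexProd n => x j) ⁻¹'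
      nearSet (y j) (E j).digit.rev ((E j).otherPlaces m α)) :=
    isClopen_iInter_of_finite fun j =>
      ((E j).isClopen_nearSet_otherPlaces m α).preimage (continuous_apply j)
  convert hmain.inter hother using 1
  ext x
  simp [subbaseSet]

theorem self_mem_subbaseSet (m : Fin (n + 1)) (α : (ω_ ((m : ℕ) : Ordinal.{0})).ToType) :
    y ∈ subbaseSet E m α :=
  ⟨self_mem_nearSet _ _ _, fun _ => self_mem_nearSet _ _ _⟩

theorem exists_subbaseSet_subset_nearSet (m : Fin (n + 1))
    (i : (ω_ ((m : ℕ) : Ordinal.{0})).ToType) :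
    ∃ k α, subbaseSet E k α ⊆ (fun x => x m) ⁻¹' nearSet (y m) (y m i) i := by
  by_cases hi : y m i = (E m).digit
  · refine ⟨m, (E m).places.symm ⟨i, hi⟩, fun x hx => ?_⟩
    simpa [hi] using hx.1
  · obtain ⟨k, hkm, α, hα⟩ := (E m).exists_le_otherPlaces ⟨i, Or.inl hi⟩
    refine ⟨⟨k, by omega⟩, α, fun x hx => ?_⟩
    rw [Set.mem_preimage, eq_rev_of_ne hi]
    exact nearSet_antitone _ _ hα (hx.2 m)

theorem isNeighborhoodSubbase_subbaseSet :
    IsNeighborhoodSubbase y (⋃ m, Set.range (subbaseSet E m)) := by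
  refine le_antisymm ?_ ?_
  · rw [nhds_pi, ← Filter.tendsto_id', Filter.tendsto_pi]
    intro m
    refine Filter.Tendsto.mono_right ?_ (generate_range_nearSet_le_nhds (y m))
    rw [Filter.Tendsto, Filter.le_generate_iff]
    rintro _ ⟨i, rfl⟩
    rw [Filter.mem_sets, Filter.mem_map]
    obtain ⟨k, α, hα⟩ := exists_subbaseSet_subset_nearSet E m i
    exact Filter.mem_of_superset
      (Filter.mem_generate_of_mem (Set.mem_iUnion.2 ⟨k, Set.mem_range_self α⟩)) hα
  · rw [Filter.le_generate_iff, Set.iUnion_subset_iff]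
    rintro m _ ⟨α, rfl⟩
    exact (isClopen_subbaseSet E m α).isOpen.mem_nhds (self_mem_subbaseSet E m α)

theorem isIndependentChains_subbaseSet : IsIndependentChains (subbaseSet E) where
  antitone := antitone_subbaseSet E
  exists_trace_eq t := by
    choose x hx hx' using fun m => (E m).exists_trace_eq (t m)
    exact ⟨x, fun m α => ⟨fun h => (hx m α).1 h.1, fun h => ⟨(hx m α).2 h, fun j => hx' j _⟩⟩⟩

theorem exists_isIndependentChains_isNeighborhoodSubbase (y : TwoLexProd n) :
    ∃ R : ∀ m : Fin (n + 1), (ω_ ((m : ℕ) : Ordinal.{0})).ToType → Set (TwoLexProd n),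
      IsIndependentChains R ∧ (∀ m α, IsClopen (R m α)) ∧
        IsNeighborhoodSubbase y (⋃ m, Set.range (R m)) :=
  have E := fun m => (DigitEnumeration.nonempty (y m)).some
  ⟨subbaseSet E, isIndependentChains_subbaseSet E, isClopen_subbaseSet E,
    isNeighborhoodSubbase_subbaseSet E⟩

end TwoLexProd

theorem mainTheorem10 (n : ℕ) :
    PinHomogeneous (TwoLexProd n) ∧
      ∀ y : TwoLexProd n,
        ∃ R : ∀ m : Fin (n + 1), (ω_ ((m : ℕ) : Ordinal.{0})).ToType → Set (TwoLexProd n),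
          (∀ m, StrictAnti (R m)) ∧
          IsNeighborhoodSubbase y (⋃ m, Set.range (R m)) ∧
          IndependentSubalgebras
            (fun m => BooleanSubalgebra.closure (Set.range (R m))) := by
  refine ⟨⟨inferInstance, inferInstance, fun a b => ?_⟩, fun y => ?_⟩
  · obtain ⟨P, hP, hPclopen, hPa⟩ :=
      TwoLexProd.exists_isIndependentChains_isNeighborhoodSubbase a
    obtain ⟨Q, hQ, hQclopen, hQb⟩ :=
      TwoLexProd.exists_isIndependentChains_isNeighborhoodSubbase b
    exact hP.pinEquivalent hPclopen hPa hQ hQclopen hQb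
  · obtain ⟨R, hR, -, hy⟩ := TwoLexProd.exists_isIndependentChains_isNeighborhoodSubbase y
    exact ⟨R, hR.strictAnti, hy, hR.independentSubalgebras⟩
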